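/- Let $M$ be a compact complex manifold and let $L$ be an ample holomorphic line bundle on $M$, i.e. some multiple $kL=L^{\otimes k}$ with $k\ge 1$ is very ample. (So $(M,L)$ is a polarized manifold; in particular $M$ is projective.) Here a line bundle $A$ on $M$ is called very ample if its base locus $\mathrm{Bs}|A|=\{p\in M: s(p)=0 \text{ for all } s\in H^0(M,A)\}$ is empty and the map $\varphi_{|A|}=[s_0:\dots:s_N]:M\to\mathbb{P}^N$ attached to a basis $s_0,\dots,s_N$ of $H^0(M,A)$ is a holomorphic embedding (an injective holomorphic immersion). Suppose that $L$ is simply generated (that is, $1$-generated): the graded algebra $$G(M,L)=\bigoplus_{i\ge 1}H^0(M,iL),\qquad iL=L^{\otimes i},$$ is generated as a $\mathbb{C}$-algebra (without unit) by $H^0(M,L)$. Then $L$ is very ample. -/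

import Mathlib

open scoped Manifold ContDiff TensorProduct DirectSum
open Bundle LinearAlgebra.Projectivization

noncomputable section

namespace PolarizedManifold

/-! ### Fibrewise tensor powers of a line bundle and their holomorphic sections

`M` is a complex manifold modelled on `E` and `L` is a holomorphic line bundle on `M`
(a vector bundle with model fibre `ℂ`).  The line bundle `kL` has fibre `⨂[ℂ]^k (L x)` at `x`. -/

section Bundle

variable {M : Type*} [TopologicalSpace M]
  {L : M → Type*} [∀ x, AddCommGroup (L x)] [∀ x, Module ℂ (L x)]
  [TopologicalSpace (TotalSpace ℂ L)]

/-- The coordinate on the fibre of `kL` at `x` induced by a local trivialization `e` of `L`: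
it sends `v₁ ⊗ ⋯ ⊗ vₖ` to `e(v₁) ⋯ e(vₖ)`. -/
def powCoord (e : Trivialization ℂ (π ℂ L)) [e.IsLinear ℂ] (k : ℕ) (x : M) :
    ⨂[ℂ]^k (L x) →ₗ[ℂ] ℂ :=
  PiTensorProduct.lift
    ((MultilinearMap.mkPiAlgebra ℂ (Fin k) ℂ).compLinearMap fun _ => e.linearMapAt ℂ x)

theorem powCoord_tprod (e : Trivialization ℂ (π ℂ L)) [e.IsLinear ℂ] (k : ℕ) (x : M)
    (v : Fin k → L x) :
    powCoord e k x (PiTensorProduct.tprod ℂ v) = ∏ i, e.linearMapAt ℂ x (v i) := by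
  simp [powCoord]

theorem powCoord_injective (e : Trivialization ℂ (π ℂ L)) [e.IsLinear ℂ] (k : ℕ) {x : M}
    (hx : x ∈ e.baseSet) : Function.Injective (powCoord e k x) := by
  have h : powCoord e k x =
      (PiTensorProduct.constantBaseRingEquiv (Fin k) ℂ).toLinearMap ∘ₗ
        (PiTensorProduct.congr fun _ => e.linearEquivAt ℂ x hx).toLinearMap := by
    refine PiTensorProduct.ext ?_
    ext v
    simp [powCoord_tprod, e.linearMapAt_def_of_mem hx]
  rw [h]
  exact (PiTensorProduct.constantBaseRingEquiv (Fin k) ℂ).injective.comp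
    (PiTensorProduct.congr fun _ => e.linearEquivAt ℂ x hx).injective

/-- The product `⨂^i (L x) × ⨂^j (L x) → ⨂^(i+j) (L x)`, `(a, b) ↦ a ⊗ b`. -/
def fibreMul (i j : ℕ) (x : M) : ⨂[ℂ]^i (L x) →ₗ[ℂ] ⨂[ℂ]^j (L x) →ₗ[ℂ] ⨂[ℂ]^(i + j) (L x) :=
  (TensorProduct.mk ℂ _ _).compr₂
    (TensorPower.mulEquiv : _ ≃ₗ[ℂ] ⨂[ℂ]^(i + j) (L x)).toLinearMap

theorem powCoord_fibreMul (e : Trivialization ℂ (π ℂ L)) [e.IsLinear ℂ] (i j : ℕ) (x : M)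
    (a : ⨂[ℂ]^i (L x)) (b : ⨂[ℂ]^j (L x)) :
    powCoord e (i + j) x (fibreMul i j x a b) = powCoord e i x a * powCoord e j x b := by
  induction a using PiTensorProduct.induction_on with
  | add a a' ha ha' => simp only [map_add, LinearMap.add_apply, ha, ha', add_mul]
  | smul_tprod r v =>
    induction b using PiTensorProduct.induction_on with
    | add b b' hb hb' => simp only [map_add, hb, hb', mul_add]
    | smul_tprod s w =>
      have h : fibreMul i j x (PiTensorProduct.tprod ℂ v) (PiTensorProduct.tprod ℂ w) =
          PiTensorProduct.tprod ℂ (Fin.append v w) := TensorPower.tprod_mul_tprod ℂ v w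
      simp only [map_smul, LinearMap.smul_apply, h, powCoord_tprod, Fin.prod_univ_add,
        Fin.append_left, Fin.append_right, smul_eq_mul]
      ring

end Bundle

section Sections

variable (E : Type*) [NormedAddCommGroup E] [NormedSpace ℂ E]
  {M : Type*} [TopologicalSpace M] [ChartedSpace E M]
  (L : M → Type*) [∀ x, AddCommGroup (L x)] [∀ x, Module ℂ (L x)]
  [∀ x, TopologicalSpace (L x)] [TopologicalSpace (TotalSpace ℂ L)]
  [FiberBundle ℂ L] [VectorBundle ℂ ℂ L]

/-- `H⁰(M, kL)`: the space of holomorphic sections of the line bundle `kL = L^{⊗ k}`, i.e. of the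
sections whose coordinate in every local trivialization of `L` is a holomorphic function. -/
def H0 (k : ℕ) : Submodule ℂ (∀ x, ⨂[ℂ]^k (L x)) where
  carrier := {σ | ∀ (e : Trivialization ℂ (π ℂ L)) [MemTrivializationAtlas e],
    ContMDiffOn 𝓘(ℂ, E) 𝓘(ℂ) ω (fun x => powCoord e k x (σ x)) e.baseSet}
  add_mem' := by
    intro σ τ hσ hτ e _
    simpa only [Pi.add_apply, map_add] using! (hσ e).add (hτ e)
  zero_mem' := by
    intro e _
    simpa only [Pi.zero_apply, map_zero] using! contMDiffOn_const
  smul_mem' := by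
    intro c σ hσ e _
    simpa only [Pi.smul_apply, map_smul, smul_eq_mul] using! contMDiffOn_const.mul (hσ e)

variable {E L}

/-- The product of sections `H⁰(M, iL) × H⁰(M, jL) → H⁰(M, (i+j)L)`. -/
def H0.mul {i j : ℕ} (σ : H0 E L i) (τ : H0 E L j) : H0 E L (i + j) :=
  ⟨fun x => fibreMul i j x (σ.1 x) (τ.1 x), by
    intro e _
    simpa only [powCoord_fibreMul] using! (σ.2 e).mul (τ.2 e)⟩

/-- The product of `G(M, L)` on homogeneous elements: the product of sections. -/
def H0.gMul {i j : ℕ+} (σ : H0 E L (i : ℕ)) (τ : H0 E L (j : ℕ)) :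
    H0 E L ((i + j : ℕ+) : ℕ) := H0.mul σ τ

theorem H0.smul_gMul {i j : ℕ+} (c : ℂ) (σ : H0 E L (i : ℕ)) (τ : H0 E L (j : ℕ)) :
    H0.gMul (c • σ) τ = c • H0.gMul σ τ :=
  Subtype.ext <| funext fun x => LinearMap.map_smul₂ (fibreMul _ _ x) c _ (τ.1 x)

theorem H0.gMul_smul {i j : ℕ+} (c : ℂ) (σ : H0 E L (i : ℕ)) (τ : H0 E L (j : ℕ)) :
    H0.gMul σ (c • τ) = c • H0.gMul σ τ :=
  Subtype.ext <| funext fun x => map_smul (fibreMul _ _ x (σ.1 x)) c (τ.1 x)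

instance : DirectSum.GNonUnitalNonAssocSemiring (fun i : ℕ+ => H0 E L (i : ℕ)) where
  mul σ τ := H0.gMul σ τ
  mul_zero _ := Subtype.ext <| funext fun x => map_zero (fibreMul _ _ x _)
  zero_mul b := Subtype.ext <| funext fun x => LinearMap.map_zero₂ (fibreMul _ _ x) (b.1 x)
  mul_add _ _ _ := Subtype.ext <| funext fun x => map_add (fibreMul _ _ x _) _ _
  add_mul _ _ c := Subtype.ext <| funext fun x => LinearMap.map_add₂ (fibreMul _ _ x) _ _ (c.1 x)

variable (E L)

/-- The graded algebra `G(M, L) = ⨁_{i ≥ 1} H⁰(M, iL)` (an algebra without unit). -/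
abbrev SectionAlgebra : Type _ := ⨁ i : ℕ+, H0 E L (i : ℕ)

/-- The homogeneous element of `G(M, L)` given by a section of `iL`. -/
abbrev SectionAlgebra.of (i : ℕ+) : H0 E L (i : ℕ) →ₗ[ℂ] SectionAlgebra E L :=
  DirectSum.lof ℂ ℕ+ (fun i : ℕ+ => H0 E L (i : ℕ)) i

theorem SectionAlgebra.of_mul_of (i j : ℕ+) (σ : H0 E L (i : ℕ)) (τ : H0 E L (j : ℕ)) :
    of E L i σ * of E L j τ = of E L (i + j) (H0.gMul σ τ) :=
  DirectSum.of_mul_of (A := fun i : ℕ+ => H0 E L (i : ℕ)) σ τ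

instance : IsScalarTower ℂ (SectionAlgebra E L) (SectionAlgebra E L) where
  smul_assoc c a b := by
    simp only [smul_eq_mul]
    induction a using DirectSum.induction_on with
    | zero => simp
    | add a a' ha ha' => simp only [smul_add, add_mul, ha, ha']
    | of i σ =>
      induction b using DirectSum.induction_on with
      | zero => simp
      | add b b' hb hb' => simp only [smul_add, mul_add, hb, hb']
      | of j τ =>
        change (c • SectionAlgebra.of E L i σ) * SectionAlgebra.of E L j τ =
          c • (SectionAlgebra.of E L i σ * SectionAlgebra.of E L j τ)
        rw [← map_smul, SectionAlgebra.of_mul_of, SectionAlgebra.of_mul_of, ← map_smul,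
          H0.smul_gMul]

instance : SMulCommClass ℂ (SectionAlgebra E L) (SectionAlgebra E L) where
  smul_comm c a b := by
    simp only [smul_eq_mul]
    induction a using DirectSum.induction_on with
    | zero => simp
    | add a a' ha ha' => simp only [smul_add, add_mul, ha, ha']
    | of i σ =>
      induction b using DirectSum.induction_on with
      | zero => simp
      | add b b' hb hb' => simp only [smul_add, mul_add, hb, hb']
      | of j τ =>
        change c • (SectionAlgebra.of E L i σ * SectionAlgebra.of E L j τ) =
          SectionAlgebra.of E L i σ * (c • SectionAlgebra.of E L j τ)
        rw [← map_smul, SectionAlgebra.of_mul_of, SectionAlgebra.of_mul_of, ← map_smul,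
          H0.gMul_smul]

/-- `L` is `r`-generated: the algebra `G(M, L)` is generated by the sections of
`H⁰(M, L), …, H⁰(M, rL)`. -/
def IsGenerated (r : ℕ) : Prop :=
  NonUnitalAlgebra.adjoin ℂ
    {a : SectionAlgebra E L | ∃ i : ℕ+, (i : ℕ) ≤ r ∧ ∃ σ, a = SectionAlgebra.of E L i σ} = ⊤

/-- `L` is simply generated: it is `1`-generated. -/
def IsSimplyGenerated : Prop := IsGenerated E L 1

end Sections

/-! ### Maps to projective space -/

section ProjectiveSpace

variable (E : Type*) [NormedAddCommGroup E] [NormedSpace ℂ E]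
  {M : Type*} [TopologicalSpace M] [ChartedSpace E M]

/-- The affine chart of `ℙᴺ` on `U_j = {z_j ≠ 0}`, with values in the affine hyperplane
`{w | w_j = 1}` of `ℂ^(N+1)`: `[z₀ : ⋯ : z_N] ↦ (z₀ / z_j, …, z_N / z_j)`.
(Outside `U_j` the value is `0`.) -/
def affineChart {N : ℕ} (j : Fin (N + 1)) (z : ℙ ℂ (Fin (N + 1) → ℂ)) : Fin (N + 1) → ℂ :=
  fun i => z.rep i / z.rep j

/-- A map from a compact complex manifold to `ℙᴺ` is a holomorphic embedding if it is an injective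
holomorphic immersion.  Holomorphy and injectivity of the differential at `p` are tested in the
affine charts `U_j` containing `φ p`; continuity of `φ` at `p` is part of the holomorphy, since the
`j`-th entry of `affineChart j` is `1` on `U_j` and `0` elsewhere. -/
structure IsHolomorphicEmbedding {N : ℕ} (φ : M → ℙ ℂ (Fin (N + 1) → ℂ)) : Prop where
  injective : Function.Injective φ
  holomorphic : ∀ (p : M) (j : Fin (N + 1)), (φ p).rep j ≠ 0 →
    ContMDiffAt 𝓘(ℂ, E) 𝓘(ℂ, Fin (N + 1) → ℂ) ω (fun x => affineChart j (φ x)) p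
  immersion : ∀ (p : M) (j : Fin (N + 1)), (φ p).rep j ≠ 0 →
    Function.Injective
      (mfderiv 𝓘(ℂ, E) 𝓘(ℂ, Fin (N + 1) → ℂ) (fun x => affineChart j (φ x)) p)

end ProjectiveSpace

/-! ### Linear systems, very ample and ample line bundles -/

section VeryAmple

variable (E : Type*) [NormedAddCommGroup E] [NormedSpace ℂ E]
  {M : Type*} [TopologicalSpace M] [ChartedSpace E M]
  (L : M → Type*) [∀ x, AddCommGroup (L x)] [∀ x, Module ℂ (L x)]
  [∀ x, TopologicalSpace (L x)] [TopologicalSpace (TotalSpace ℂ L)]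
  [FiberBundle ℂ L] [VectorBundle ℂ ℂ L]

/-- The base locus `Bs |kL|`: the common zeros of all the sections of `kL`. -/
def baseLocus (k : ℕ) : Set M := {p | ∀ σ : H0 E L k, σ.1 p = 0}

variable {E L}

theorem exists_basis_ne_zero {k : ℕ} (hBs : baseLocus E L k = ∅) {ι : Type*}
    (s : Module.Basis ι ℂ (H0 E L k)) (p : M) : ∃ i, (s i).1 p ≠ 0 := by
  by_contra! h
  have hp : p ∈ baseLocus E L k := by
    intro σ
    let ev : H0 E L k →ₗ[ℂ] ⨂[ℂ]^k (L p) := (LinearMap.proj p).comp (H0 E L k).subtype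
    have : ev = 0 := s.ext fun i => h i
    exact LinearMap.congr_fun this σ
  simp [hBs] at hp

/-- The map `φ_{|kL|} : M → ℙᴺ`, `p ↦ [s₀(p) : ⋯ : s_N(p)]`, attached to a basis `s₀, …, s_N` of
`H⁰(M, kL)` when `Bs |kL| = ∅`.  The values `sᵢ(p)` are read in a local trivialization at `p`; the
point of `ℙᴺ` does not depend on it. -/
def linearSystemMap {k N : ℕ} (hBs : baseLocus E L k = ∅)
    (s : Module.Basis (Fin (N + 1)) ℂ (H0 E L k)) (p : M) : ℙ ℂ (Fin (N + 1) → ℂ) :=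
  Projectivization.mk ℂ (fun i => powCoord (trivializationAt ℂ L p) k p ((s i).1 p)) <| by
    obtain ⟨i, hi⟩ := exists_basis_ne_zero hBs s p
    intro h
    refine hi (powCoord_injective (trivializationAt ℂ L p) k
      (FiberBundle.mem_baseSet_trivializationAt' p) ?_)
    rw [map_zero]
    exact congrFun h i

variable (E L)

/-- `kL` is very ample (on a compact complex manifold): the complete linear system `|kL|` is base
point free and `φ_{|kL|}` is a holomorphic embedding into a projective space. -/
def IsVeryAmplePow (k : ℕ) : Prop :=
  ∃ (hBs : baseLocus E L k = ∅) (N : ℕ) (s : Module.Basis (Fin (N + 1)) ℂ (H0 E L k)),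
    IsHolomorphicEmbedding E (linearSystemMap hBs s)

/-- `L` is very ample. -/
def IsVeryAmple : Prop := IsVeryAmplePow E L 1

/-- `L` is ample: some positive multiple `kL` is very ample. -/
def IsAmple : Prop := ∃ k : ℕ, 1 ≤ k ∧ IsVeryAmplePow E L k

end VeryAmple

end PolarizedManifold

end

/-! Simple generation says that every section of `kL`, `k ≥ 1`, is a polynomial in sections of `L`.
Hence any multiplicative defect of the sections of `L` is inherited by those of `kL`: a common zero,
a pair of points where all values are proportional, a tangent vector along which all ratios have
derivative zero. When `kL` is very ample none of these defects occurs for it, so none occurs for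
`L`.

The inheritance principle is `IsSimplyGenerated.mem_of_mul_mem`; its three applications are
`baseLocus_one_subset`, `powCoord_eq_pow_mul` and `mem_flatSections`. A basis of `H⁰(M, L)` with
finite index set is also needed; finiteness comes from that of `H⁰(M, kL)` through `finite_H0_one`.
-/

namespace PolarizedManifold

/-! ### Change of trivialization in the fibres of `kL`. -/

section Coordinates

variable {M : Type*} [TopologicalSpace M]
  {L : M → Type*} [∀ x, AddCommGroup (L x)] [∀ x, Module ℂ (L x)]
  [TopologicalSpace (TotalSpace ℂ L)]

theorem powCoord_eq_zero_iff (e : Trivialization ℂ (π ℂ L)) [e.IsLinear ℂ] (k : ℕ) {x : M}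
    (hx : x ∈ e.baseSet) (a : ⨂[ℂ]^k (L x)) : powCoord e k x a = 0 ↔ a = 0 :=
  map_eq_zero_iff _ (powCoord_injective e k hx)

/-- Changing the trivialization multiplies the fibre coordinate by a nonzero scalar. -/
theorem exists_powCoord_eq_mul (e e' : Trivialization ℂ (π ℂ L)) [e.IsLinear ℂ] [e'.IsLinear ℂ]
    (k : ℕ) {x : M} (hx : x ∈ e.baseSet) (hx' : x ∈ e'.baseSet) :
    ∃ c : ℂ, c ≠ 0 ∧ ∀ a, powCoord e' k x a = c * powCoord e k x a := by
  let f := (e.linearEquivAt ℂ x hx).symm.trans (e'.linearEquivAt ℂ x hx')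
  have hf (v : L x) : e'.linearMapAt ℂ x v = f 1 * e.linearMapAt ℂ x v := by
    have h1 : e'.linearMapAt ℂ x v = f (e.linearMapAt ℂ x v) := by
      rw [e.linearMapAt_def_of_mem hx, e'.linearMapAt_def_of_mem hx']
      change _ = e'.linearEquivAt ℂ x hx' ((e.linearEquivAt ℂ x hx).symm (e.linearEquivAt ℂ x hx v))
      rw [LinearEquiv.symm_apply_apply]
      rfl
    rw [h1, mul_comm, ← smul_eq_mul, ← map_smul, smul_eq_mul, mul_one]
  -- `f 1` is the value at `x` of the transition function of `L`; that of `kL` is its `k`-th power.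
  refine ⟨f 1 ^ k, pow_ne_zero _ ((map_ne_zero_iff _ f.injective).2 one_ne_zero), fun a => ?_⟩
  have h : powCoord e' k x = f 1 ^ k • powCoord e k x := by
    refine PiTensorProduct.ext ?_
    ext v
    simp [powCoord_tprod, hf, Finset.prod_mul_distrib]
  rw [h, LinearMap.smul_apply, smul_eq_mul]

theorem powCoord_div_powCoord (e e' : Trivialization ℂ (π ℂ L)) [e.IsLinear ℂ] [e'.IsLinear ℂ]
    (k : ℕ) {x : M} (hx : x ∈ e.baseSet) (hx' : x ∈ e'.baseSet) (a b : ⨂[ℂ]^k (L x)) :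
    powCoord e' k x a / powCoord e' k x b = powCoord e k x a / powCoord e k x b := by
  obtain ⟨c, hc, h⟩ := exists_powCoord_eq_mul e e' k hx hx'
  rw [h, h, mul_div_mul_left _ _ hc]

end Coordinates

/-! ### Products of sections and consequences of simple generation. -/

section Sections

variable {E : Type*} [NormedAddCommGroup E] [NormedSpace ℂ E]
  {M : Type*} [TopologicalSpace M] [ChartedSpace E M]
  {L : M → Type*} [∀ x, AddCommGroup (L x)] [∀ x, Module ℂ (L x)]
  [∀ x, TopologicalSpace (L x)] [TopologicalSpace (TotalSpace ℂ L)]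
  [FiberBundle ℂ L] [VectorBundle ℂ ℂ L]

theorem H0.powCoord_mul (e : Trivialization ℂ (π ℂ L)) [e.IsLinear ℂ] {i j : ℕ} (σ : H0 E L i)
    (τ : H0 E L j) (x : M) :
    powCoord e (i + j) x ((H0.mul σ τ).1 x) = powCoord e i x (σ.1 x) * powCoord e j x (τ.1 x) :=
  powCoord_fibreMul e i j x _ _

theorem H0.contMDiffAt_powCoord {k : ℕ} (σ : H0 E L k) (e : Trivialization ℂ (π ℂ L))
    [MemTrivializationAtlas e] {p : M} (hp : p ∈ e.baseSet) :
    ContMDiffAt 𝓘(ℂ, E) 𝓘(ℂ) ω (fun x => powCoord e k x (σ.1 x)) p :=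
  (σ.2 e).contMDiffAt (e.open_baseSet.mem_nhds hp)

theorem H0.eventually_powCoord_ne_zero {k : ℕ} (σ : H0 E L k) {p : M} (h : σ.1 p ≠ 0)
    (e : Trivialization ℂ (π ℂ L)) [MemTrivializationAtlas e] (hp : p ∈ e.baseSet) :
    ∀ᶠ x in nhds p, powCoord e k x (σ.1 x) ≠ 0 :=
  (H0.contMDiffAt_powCoord σ e hp).continuousAt.eventually_ne
    ((powCoord_eq_zero_iff e k hp _).not.2 h)

theorem H0.eventually_ne_zero {k : ℕ} (σ : H0 E L k) {p : M} (h : σ.1 p ≠ 0) :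
    ∀ᶠ x in nhds p, σ.1 x ≠ 0 := by
  filter_upwards [H0.eventually_powCoord_ne_zero σ h (trivializationAt ℂ L p)
    (FiberBundle.mem_baseSet_trivializationAt' p)] with x hx h0
  exact hx (by rw [h0, map_zero])

/-- For a section `s` of `L` there is a section of `kL`, namely `s ^ k`, without zeros outside those
of `s`. -/
theorem H0.exists_pow (s : H0 E L 1) (k : ℕ) :
    ∃ t : H0 E L k, ∀ (x : M), s.1 x ≠ 0 → t.1 x ≠ 0 := by
  induction k with
  | zero =>
    refine ⟨⟨fun x => PiTensorProduct.tprod ℂ Fin.elim0, fun e _ => ?_⟩, fun x _ h => ?_⟩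
    · simpa [powCoord_tprod] using! contMDiffOn_const
    · have := congrArg (powCoord (trivializationAt ℂ L x) 0 x) h
      simp [powCoord_tprod] at this
  | succ k ih =>
    obtain ⟨t, ht⟩ := ih
    refine ⟨H0.mul t s, fun x hx h => ?_⟩
    have hb := FiberBundle.mem_baseSet_trivializationAt' (F := ℂ) (E := L) x
    rw [← powCoord_eq_zero_iff (trivializationAt ℂ L x) _ hb, H0.powCoord_mul, mul_eq_zero,
      powCoord_eq_zero_iff _ _ hb, powCoord_eq_zero_iff _ _ hb] at h
    exact h.elim (ht x hx) hx

/-- Multiplication by a section, as a linear map. -/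
def H0.mulLeft {i : ℕ} (σ : H0 E L i) (j : ℕ) : H0 E L j →ₗ[ℂ] H0 E L (i + j) where
  toFun τ := H0.mul σ τ
  map_add' _ _ := Subtype.ext <| funext fun x => map_add (fibreMul _ _ x (σ.1 x)) _ _
  map_smul' _ _ := Subtype.ext <| funext fun x => map_smul (fibreMul _ _ x (σ.1 x)) _ _

/-- If `|L|` has no base points on a compact manifold and some `H⁰(M, (k + 1)L)` is finite
dimensional, then so is `H⁰(M, L)`. -/
theorem finite_H0_one [CompactSpace M] (hBs : baseLocus E L 1 = ∅) (k : ℕ)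
    [Module.Finite ℂ (H0 E L (k + 1))] : Module.Finite ℂ (H0 E L 1) := by
  have hs (x : M) : ∃ t : H0 E L k, t.1 x ≠ 0 := by
    have hx : x ∉ baseLocus E L 1 := by simp [hBs]
    obtain ⟨s, hs⟩ := not_forall.1 hx
    obtain ⟨t, ht⟩ := H0.exists_pow s k
    exact ⟨t, ht x hs⟩
  choose t ht using hs
  obtain ⟨F, -, hF⟩ := isCompact_univ.elim_nhds_subcover (fun x => {y | (t x).1 y ≠ 0})
    fun x _ => H0.eventually_ne_zero (t x) (ht x)
  -- Finitely many sections `t x` of `kL` have no common zero, so `σ` is determined by its products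
  -- with them. Connectedness of `M` plays no role.
  refine Module.Finite.of_injective
    (LinearMap.pi fun x : F => H0.mulLeft (t x) 1 : H0 E L 1 →ₗ[ℂ] F → H0 E L (k + 1)) ?_
  rw [injective_iff_map_eq_zero]
  intro σ hσ
  ext1
  funext y
  obtain ⟨x, hxF, hxy⟩ := Set.mem_iUnion₂.1 (hF (Set.mem_univ y))
  have hb := FiberBundle.mem_baseSet_trivializationAt' (F := ℂ) (E := L) y
  have h0 : (H0.mul (t x) σ).1 y = 0 := congrFun (congrArg Subtype.val (congrFun hσ ⟨x, hxF⟩)) y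
  rw [← powCoord_eq_zero_iff (trivializationAt ℂ L y) _ hb, H0.powCoord_mul, mul_eq_zero,
    powCoord_eq_zero_iff _ _ hb, powCoord_eq_zero_iff _ _ hb] at h0
  exact h0.resolve_left hxy

/-- If `L` is simply generated, then a graded family of subspaces of the `H⁰(M, iL)` that is
closed under products and contains `H⁰(M, L)` is everything. -/
theorem IsSimplyGenerated.mem_of_mul_mem (hgen : IsSimplyGenerated E L)
    (P : ∀ i : ℕ, Submodule ℂ (H0 E L i)) (one : ∀ σ, σ ∈ P 1)
    (mul : ∀ {i j : ℕ} (σ : H0 E L i) (τ : H0 E L j), σ ∈ P i → τ ∈ P j → H0.mul σ τ ∈ P (i + j))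
    {i : ℕ} (hi : 1 ≤ i) (σ : H0 E L i) : σ ∈ P i := by
  classical
  let Q : Submodule ℂ (SectionAlgebra E L) :=
    { carrier := {a | ∀ i : ℕ+, a i ∈ P i}
      add_mem' := fun ha hb i => (P i).add_mem (ha i) (hb i)
      zero_mem' := fun i => (P i).zero_mem
      smul_mem' := fun c a ha i => (P i).smul_mem c (ha i) }
  have hof (i : ℕ+) (σ : H0 E L (i : ℕ)) (h : σ ∈ P i) : SectionAlgebra.of E L i σ ∈ Q := by
    intro j
    by_cases hij : i = j
    · subst hij
      rwa [DirectSum.lof_apply]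
    · rw [show SectionAlgebra.of E L i σ j = 0 from DFinsupp.single_eq_of_ne (Ne.symm hij)]
      exact (P j).zero_mem
  have hQ (a : SectionAlgebra E L)
      (ha : a ∈ NonUnitalAlgebra.adjoin ℂ {a : SectionAlgebra E L |
        ∃ i : ℕ+, (i : ℕ) ≤ 1 ∧ ∃ σ, a = SectionAlgebra.of E L i σ}) : a ∈ Q := by
    induction ha using NonUnitalAlgebra.adjoin_induction with
    | mem a ha =>
      obtain ⟨i, hi, σ, rfl⟩ := ha
      obtain rfl : i = 1 := le_antisymm hi (one_le : 1 ≤ i)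
      exact hof 1 σ (one σ)
    | add a b _ _ ha hb => exact Q.add_mem ha hb
    | zero => exact Q.zero_mem
    | smul c a _ ha => exact Q.smul_mem c ha
    | mul a b _ _ ha hb =>
      -- Splitting both factors into homogeneous components reduces to products of two homogeneous
      -- elements.
      rw [← DirectSum.sum_support_of a, ← DirectSum.sum_support_of b, Finset.sum_mul_sum]
      refine Q.sum_mem fun i _ => Q.sum_mem fun j _ => ?_
      rw [show DirectSum.of (fun i : ℕ+ => H0 E L (i : ℕ)) i (a i) *
        DirectSum.of (fun i : ℕ+ => H0 E L (i : ℕ)) j (b j) =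
          SectionAlgebra.of E L (i + j) (H0.gMul (a i) (b j)) from
        SectionAlgebra.of_mul_of E L i j _ _]
      exact hof _ _ (mul _ _ (ha i) (hb j))
  have h := hQ (SectionAlgebra.of E L ⟨i, hi⟩ σ)
    ((show NonUnitalAlgebra.adjoin ℂ _ = ⊤ from hgen) ▸ NonUnitalAlgebra.mem_top) ⟨i, hi⟩
  rwa [show SectionAlgebra.of E L ⟨i, hi⟩ σ ⟨i, hi⟩ = σ from DirectSum.lof_apply ℂ _ _] at h

theorem IsSimplyGenerated.baseLocus_one_subset (hgen : IsSimplyGenerated E L) {k : ℕ}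
    (hk : 1 ≤ k) : baseLocus E L 1 ⊆ baseLocus E L k := by
  intro p hp σ
  refine hgen.mem_of_mul_mem
    (fun i => LinearMap.ker ((LinearMap.proj p).comp (H0 E L i).subtype)) hp ?_ hk σ
  intro i j σ τ hσ _
  have hσ : σ.1 p = 0 := hσ
  change fibreMul i j p (σ.1 p) (τ.1 p) = 0
  rw [hσ, LinearMap.map_zero₂]

/-- If the coordinates of all sections of `L` at `p` and `q` are proportional with factor `c`, then
those of all sections of `kL` are proportional with factor `c ^ k`. -/
theorem IsSimplyGenerated.powCoord_eq_pow_mul (hgen : IsSimplyGenerated E L)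
    (e e' : Trivialization ℂ (π ℂ L)) [e.IsLinear ℂ] [e'.IsLinear ℂ] {p q : M} {c : ℂ}
    (h : ∀ σ : H0 E L 1, powCoord e 1 p (σ.1 p) = c * powCoord e' 1 q (σ.1 q))
    {k : ℕ} (hk : 1 ≤ k) (σ : H0 E L k) :
    powCoord e k p (σ.1 p) = c ^ k * powCoord e' k q (σ.1 q) := by
  let P (i : ℕ) : Submodule ℂ (H0 E L i) :=
    LinearMap.eqLocus
      ((powCoord e i p).comp ((LinearMap.proj p).comp (H0 E L i).subtype))
      (c ^ i • (powCoord e' i q).comp ((LinearMap.proj q).comp (H0 E L i).subtype))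
  have hP {i : ℕ} (σ : H0 E L i) :
      σ ∈ P i ↔ powCoord e i p (σ.1 p) = c ^ i * powCoord e' i q (σ.1 q) := Iff.rfl
  refine hgen.mem_of_mul_mem P (fun σ => ?_) (fun σ τ hσ hτ => ?_) hk σ
  · rw [hP, pow_one]
    exact h σ
  · rw [hP] at hσ hτ ⊢
    rw [H0.powCoord_mul, H0.powCoord_mul, hσ, hτ]
    ring

end Sections

/-! ### Functions whose derivative along a fixed tangent vector vanishes. -/

section FlatFunctions

variable {E : Type*} [NormedAddCommGroup E] [NormedSpace ℂ E]
  {M : Type*} [TopologicalSpace M] [ChartedSpace E M]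

/-- `f` is differentiable at `p` and its derivative vanishes on the tangent vector `v`. -/
def IsFlatAlong (p : M) (v : TangentSpace 𝓘(ℂ, E) p) (f : M → ℂ) : Prop :=
  ∃ f' : TangentSpace 𝓘(ℂ, E) p →L[ℂ] ℂ, HasMFDerivAt 𝓘(ℂ, E) 𝓘(ℂ) f p f' ∧ f' v = 0

namespace IsFlatAlong

variable {p : M} {v : TangentSpace 𝓘(ℂ, E) p} {f g : M → ℂ}

theorem const (c : ℂ) : IsFlatAlong p v fun _ => c := ⟨0, hasMFDerivAt_const c p, rfl⟩

theorem add (hf : IsFlatAlong p v f) (hg : IsFlatAlong p v g) : IsFlatAlong p v (f + g) := by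
  obtain ⟨f', hf, hf0⟩ := hf
  obtain ⟨g', hg, hg0⟩ := hg
  exact ⟨f' + g', hf.add hg, by simp [hf0, hg0]⟩

theorem mul (hf : IsFlatAlong p v f) (hg : IsFlatAlong p v g) : IsFlatAlong p v (f * g) := by
  obtain ⟨f', hf, hf0⟩ := hf
  obtain ⟨g', hg, hg0⟩ := hg
  exact ⟨f p • g' + g p • f', hf.mul hg, by simp [hf0, hg0]⟩

theorem inv (hf : IsFlatAlong p v f) (h : f p ≠ 0) : IsFlatAlong p v fun x => (f x)⁻¹ := by
  obtain ⟨f', hf, hf0⟩ := hf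
  obtain ⟨A, hA⟩ : ∃ A : ℂ →L[ℂ] ℂ, HasFDerivAt (fun z : ℂ => z⁻¹) A (f p) :=
    ⟨_, (hasDerivAt_inv h).hasFDerivAt⟩
  exact ⟨A.comp f', HasMFDerivAt.comp p hA.hasMFDerivAt hf, (congrArg A hf0).trans (map_zero A)⟩

theorem congr (hf : IsFlatAlong p v f) (h : g =ᶠ[nhds p] f) : IsFlatAlong p v g :=
  hf.imp fun _ hf' => ⟨hf'.1.congr_of_eventuallyEq h, hf'.2⟩

end IsFlatAlong

theorem isFlatAlong_apply_iff {ι : Type*} [Fintype ι] {p : M} (v : TangentSpace 𝓘(ℂ, E) p)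
    {F : M → ι → ℂ} (hF : MDifferentiableAt 𝓘(ℂ, E) 𝓘(ℂ, ι → ℂ) F p) :
    (∀ i, IsFlatAlong p v fun x => F x i) ↔ mfderiv 𝓘(ℂ, E) 𝓘(ℂ, ι → ℂ) F p v = 0 := by
  have h (i : ι) : HasMFDerivAt 𝓘(ℂ, E) 𝓘(ℂ) (fun x => F x i) p
      ((ContinuousLinearMap.proj (R := ℂ) (φ := fun _ : ι => ℂ) i).comp
        (mfderiv 𝓘(ℂ, E) 𝓘(ℂ, ι → ℂ) F p)) :=
    HasMFDerivAt.comp p (ContinuousLinearMap.proj (R := ℂ) (φ := fun _ : ι => ℂ) i).hasMFDerivAt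
      hF.hasMFDerivAt
  constructor
  · intro hv
    funext i
    obtain ⟨f', hf', h0⟩ := hv i
    rw [hasMFDerivAt_unique hf' (h i)] at h0
    exact h0
  · intro hv i
    exact ⟨_, h i, congrFun hv i⟩

end FlatFunctions

/-! ### The map of a linear system in coordinates. -/

section LinearSystemMap

variable {E : Type*} [NormedAddCommGroup E] [NormedSpace ℂ E]
  {M : Type*} [TopologicalSpace M] [ChartedSpace E M]
  {L : M → Type*} [∀ x, AddCommGroup (L x)] [∀ x, Module ℂ (L x)]
  [∀ x, TopologicalSpace (L x)] [TopologicalSpace (TotalSpace ℂ L)]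
  [FiberBundle ℂ L] [VectorBundle ℂ ℂ L]
  {k N : ℕ} (hBs : baseLocus E L k = ∅) (s : Module.Basis (Fin (N + 1)) ℂ (H0 E L k))

theorem exists_smul_eq_rep_linearSystemMap (x : M) :
    ∃ a : ℂˣ, a • (fun i => powCoord (trivializationAt ℂ L x) k x ((s i).1 x)) =
      (linearSystemMap hBs s x).rep :=
  Projectivization.exists_smul_eq_mk_rep ℂ _ _

/-- `linearSystemMap` reads each point in its own trivialization, but ratios of coordinates do not
depend on it. A single `e` therefore describes the map on all of its base set, which gives access to
derivatives. -/
theorem affineChart_linearSystemMap (e : Trivialization ℂ (π ℂ L)) [e.IsLinear ℂ] {x : M}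
    (hx : x ∈ e.baseSet) (j i : Fin (N + 1)) :
    affineChart j (linearSystemMap hBs s x) i =
      powCoord e k x ((s i).1 x) / powCoord e k x ((s j).1 x) := by
  rw [powCoord_div_powCoord (trivializationAt ℂ L x) e k
    (FiberBundle.mem_baseSet_trivializationAt' x) hx]
  obtain ⟨a, ha⟩ := exists_smul_eq_rep_linearSystemMap hBs s x
  rw [affineChart, ← ha]
  exact mul_div_mul_left _ _ a.ne_zero

theorem rep_linearSystemMap_ne_zero_iff (p : M) (j : Fin (N + 1)) :
    (linearSystemMap hBs s p).rep j ≠ 0 ↔ (s j).1 p ≠ 0 := by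
  obtain ⟨a, ha⟩ := exists_smul_eq_rep_linearSystemMap hBs s p
  rw [← ha, Pi.smul_apply, Units.smul_def, smul_eq_mul, mul_ne_zero_iff, Ne, Ne,
    powCoord_eq_zero_iff _ _ (FiberBundle.mem_baseSet_trivializationAt' p)]
  exact and_iff_right a.ne_zero

theorem contMDiffAt_affineChart_linearSystemMap {p : M} {j : Fin (N + 1)} (hj : (s j).1 p ≠ 0) :
    ContMDiffAt 𝓘(ℂ, E) 𝓘(ℂ, Fin (N + 1) → ℂ) ω
      (fun x => affineChart j (linearSystemMap hBs s x)) p := by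
  have hb := FiberBundle.mem_baseSet_trivializationAt' (F := ℂ) (E := L) p
  rw [contMDiffAt_pi_space]
  intro i
  refine ((H0.contMDiffAt_powCoord (s i) _ hb).div₀ (H0.contMDiffAt_powCoord (s j) _ hb)
    ((powCoord_eq_zero_iff _ _ hb _).not.2 hj)).congr_of_eventuallyEq ?_
  filter_upwards [(trivializationAt ℂ L p).open_baseSet.mem_nhds hb] with x hx
  exact affineChart_linearSystemMap hBs s _ hx j i

/-- Proportionality on a basis extends linearly to all sections. The basis-free form is what passes
from `L` to `kL`. -/
theorem linearSystemMap_eq_iff (p q : M) :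
    linearSystemMap hBs s p = linearSystemMap hBs s q ↔
      ∃ c : ℂ, c ≠ 0 ∧ ∀ σ : H0 E L k, powCoord (trivializationAt ℂ L p) k p (σ.1 p) =
        c * powCoord (trivializationAt ℂ L q) k q (σ.1 q) := by
  unfold linearSystemMap
  rw [Projectivization.mk_eq_mk_iff]
  constructor
  · rintro ⟨c, hc⟩
    refine ⟨c, c.ne_zero, fun σ => ?_⟩
    let f : H0 E L k →ₗ[ℂ] ℂ :=
      (powCoord (trivializationAt ℂ L p) k p).comp ((LinearMap.proj p).comp (H0 E L k).subtype)
    let g : H0 E L k →ₗ[ℂ] ℂ :=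
      (powCoord (trivializationAt ℂ L q) k q).comp ((LinearMap.proj q).comp (H0 E L k).subtype)
    have h : f = (c : ℂ) • g := s.ext fun i => (congrFun hc i).symm
    exact LinearMap.congr_fun h σ
  · rintro ⟨c, hc, h⟩
    exact ⟨Units.mk0 c hc, funext fun i => (h (s i)).symm⟩

end LinearSystemMap

/-! ### From an embedding by `kL` to an embedding by `L`. -/

section VeryAmple

variable {E : Type*} [NormedAddCommGroup E] [NormedSpace ℂ E]
  {M : Type*} [TopologicalSpace M] [ChartedSpace E M]
  {L : M → Type*} [∀ x, AddCommGroup (L x)] [∀ x, Module ℂ (L x)]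
  [∀ x, TopologicalSpace (L x)] [TopologicalSpace (TotalSpace ℂ L)]
  [FiberBundle ℂ L] [VectorBundle ℂ ℂ L]

/-- The sections `σ` of `kL` such that `σ g` is flat along `v`, read in a trivialization of `L`. -/
def flatSections (e : Trivialization ℂ (π ℂ L)) [e.IsLinear ℂ] {p : M}
    (v : TangentSpace 𝓘(ℂ, E) p) (g : M → ℂ) (k : ℕ) : Submodule ℂ (H0 E L k) where
  carrier := {σ | IsFlatAlong p v fun x => powCoord e k x (σ.1 x) * g x}
  add_mem' {σ τ} hσ hτ := (IsFlatAlong.add hσ hτ).congr <| .of_forall fun x =>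
    (congrArg (· * g x) (map_add (powCoord e k x) (σ.1 x) (τ.1 x))).trans (add_mul _ _ _)
  zero_mem' := (IsFlatAlong.const 0).congr <| .of_forall fun x =>
    (congrArg (· * g x) (map_zero (powCoord e k x))).trans (zero_mul _)
  smul_mem' c σ hσ := ((IsFlatAlong.const c).mul hσ).congr <| .of_forall fun x =>
    (congrArg (· * g x) (map_smul (powCoord e k x) c (σ.1 x))).trans (mul_assoc _ _ _)

theorem mem_flatSections_iff (e : Trivialization ℂ (π ℂ L)) [e.IsLinear ℂ] {p : M}
    (v : TangentSpace 𝓘(ℂ, E) p) (g : M → ℂ) {k : ℕ} (σ : H0 E L k) :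
    σ ∈ flatSections e v g k ↔ IsFlatAlong p v fun x => powCoord e k x (σ.1 x) * g x := Iff.rfl

/-- If `σ g` is flat along `v` for all sections `σ` of `L`, then so is `σ g ^ k` for all sections
`σ` of `kL`. -/
theorem IsSimplyGenerated.mem_flatSections (hgen : IsSimplyGenerated E L)
    (e : Trivialization ℂ (π ℂ L)) [e.IsLinear ℂ] {p : M} {v : TangentSpace 𝓘(ℂ, E) p} (g : M → ℂ)
    (h : ∀ σ : H0 E L 1, σ ∈ flatSections e v g 1) {k : ℕ} (hk : 1 ≤ k) (σ : H0 E L k) :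
    σ ∈ flatSections e v (g ^ k) k := by
  refine hgen.mem_of_mul_mem (fun i => flatSections e v (g ^ i) i) (fun σ => ?_)
    (fun {i j} σ τ hσ hτ => ?_) hk σ
  · simpa only [pow_one] using h σ
  · refine (IsFlatAlong.mul hσ hτ).congr <| .of_forall fun x => ?_
    simp only [Pi.mul_apply, Pi.pow_apply, H0.powCoord_mul]
    ring

theorem IsSimplyGenerated.isHolomorphicEmbedding (hgen : IsSimplyGenerated E L)
    {k N N' : ℕ} (hk : 1 ≤ k) (hBs : baseLocus E L k = ∅)
    (t : Module.Basis (Fin (N' + 1)) ℂ (H0 E L k))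
    (ht : IsHolomorphicEmbedding E (linearSystemMap hBs t)) (hBs₁ : baseLocus E L 1 = ∅)
    (s : Module.Basis (Fin (N + 1)) ℂ (H0 E L 1)) :
    IsHolomorphicEmbedding E (linearSystemMap hBs₁ s) where
  injective p q hpq := by
    refine ht.injective ?_
    rw [linearSystemMap_eq_iff] at hpq ⊢
    obtain ⟨c, hc, h⟩ := hpq
    exact ⟨c ^ k, pow_ne_zero k hc, hgen.powCoord_eq_pow_mul _ _ h hk⟩
  holomorphic p j hj :=
    contMDiffAt_affineChart_linearSystemMap hBs₁ s
      ((rep_linearSystemMap_ne_zero_iff hBs₁ s p j).1 hj)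
  immersion p j hj := by
    rw [rep_linearSystemMap_ne_zero_iff] at hj
    rw [injective_iff_map_eq_zero]
    intro v hv
    let e := trivializationAt ℂ L p
    have hb : p ∈ e.baseSet := FiberBundle.mem_baseSet_trivializationAt' p
    have hB : ∀ᶠ x in nhds p, x ∈ e.baseSet := e.open_baseSet.mem_nhds hb
    rw [← isFlatAlong_apply_iff v ((contMDiffAt_affineChart_linearSystemMap hBs₁ s
      hj).mdifferentiableAt (by simp))] at hv
    -- Dividing by `s j` turns sections of `L` into functions near `p`; dividing by its `k`-th power
    -- does so for `kL`.
    let g : M → ℂ := fun x => (powCoord e 1 x ((s j).1 x))⁻¹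
    have hs (i) : s i ∈ flatSections e v g 1 := (hv i).congr <| by
      filter_upwards [hB] with x hx
      rw [affineChart_linearSystemMap hBs₁ s e hx, div_eq_mul_inv]
    have hflat := hgen.mem_flatSections e g (fun σ => Submodule.span_le.2
      (Set.range_subset_iff.2 hs) (s.mem_span σ)) hk
    obtain ⟨J, hJ⟩ := exists_basis_ne_zero hBs t p
    refine (injective_iff_map_eq_zero _).1
      (ht.immersion p J ((rep_linearSystemMap_ne_zero_iff hBs t p J).2 hJ)) v ?_
    rw [← isFlatAlong_apply_iff v ((contMDiffAt_affineChart_linearSystemMap hBs t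
      hJ).mdifferentiableAt (by simp))]
    intro i
    have hg : g p ≠ 0 := inv_ne_zero ((powCoord_eq_zero_iff e 1 hb _).not.2 hj)
    -- The ratio `t i / t J` is the quotient of the flat functions `t i * g ^ k` and `t J * g ^ k`,
    -- the second nonzero at `p`; the factor `g ^ k` cancels where `s j` does not vanish.
    refine (((mem_flatSections_iff _ _ _ _).1 (hflat (t i))).mul
      (((mem_flatSections_iff _ _ _ _).1 (hflat (t J))).inv (mul_ne_zero
      ((powCoord_eq_zero_iff e k hb _).not.2 hJ) (pow_ne_zero k hg)))).congr ?_
    filter_upwards [hB, H0.eventually_powCoord_ne_zero (s j) hj e hb] with x hx hsx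
    rw [affineChart_linearSystemMap hBs t e hx, Pi.mul_apply, ← div_eq_mul_inv]
    exact (mul_div_mul_right _ _ (pow_ne_zero k (inv_ne_zero hsx))).symm

end VeryAmple

end PolarizedManifold

theorem mainTheorem9
    {E : Type*} [NormedAddCommGroup E] [NormedSpace ℂ E] [FiniteDimensional ℂ E]
    {M : Type*} [TopologicalSpace M] [T2Space M] [CompactSpace M]
    [ChartedSpace E M] [IsManifold 𝓘(ℂ, E) ω M]
    (L : M → Type*) [∀ x, AddCommGroup (L x)] [∀ x, Module ℂ (L x)]
    [∀ x, TopologicalSpace (L x)] [TopologicalSpace (TotalSpace ℂ L)]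
    [FiberBundle ℂ L] [VectorBundle ℂ ℂ L] [ContMDiffVectorBundle ω ℂ L 𝓘(ℂ, E)]
    (hL : PolarizedManifold.IsAmple E L)
    (hgen : PolarizedManifold.IsSimplyGenerated E L) :
    PolarizedManifold.IsVeryAmple E L := by
  open PolarizedManifold in
  obtain ⟨k, hk, hBs, N', t, ht⟩ := hL
  have hBs₁ : baseLocus E L 1 = ∅ :=
    Set.subset_eq_empty (hgen.baseLocus_one_subset hk) hBs
  obtain ⟨m, rfl⟩ : ∃ m, k = m + 1 := ⟨k - 1, by omega⟩
  have : Module.Finite ℂ (H0 E L (m + 1)) := Module.Finite.of_basis t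
  have := finite_H0_one hBs₁ m
  -- The basis must be indexed by some `Fin (N + 1)`, so dimension zero has to be excluded. If
  -- `H⁰(M, L) = 0`, every point is a base point, so `M` is empty and the basis vector `t 0`
  -- vanishes.
  have : Nontrivial (H0 E L 1) := by
    by_contra hn
    rw [not_nontrivial_iff_subsingleton] at hn
    refine t.ne_zero 0 (Subtype.ext <| funext fun p => ?_)
    have hp : p ∈ baseLocus E L 1 := fun σ => by rw [Subsingleton.elim σ 0]; rfl
    simp [hBs₁] at hp
  have hpos : 0 < Module.finrank ℂ (H0 E L 1) := Module.finrank_pos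
  refine ⟨hBs₁, Module.finrank ℂ (H0 E L 1) - 1,
    (Module.finBasis ℂ (H0 E L 1)).reindex (finCongr (by omega)), ?_⟩
  exact hgen.isHolomorphicEmbedding hk hBs t ht hBs₁ _
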